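/- Let $k$ be a field and let $H$ be a Hopf algebra over $k$ that is co-Frobenius, i.e. there is a nonzero linear functional $\lambda : H \to k$ which is a left integral ($\sum \lambda(h_{(2)})h_{(1)} = \lambda(h)1$ for all $h \in H$) or a right integral ($\sum \lambda(h_{(1)})h_{(2)} = \lambda(h)1$ for all $h \in H$). For a right $H$-comodule $M$, let $E(M)$ denote its injective hull in the category of right $H$-comodules, and regard $k$ as the trivial right $H$-comodule, with coaction $a \mapsto a \otimes 1$. Then $E(k)$ is finite dimensional. Let $d$ be the largest dimension of a composition factor of $E(k)$. Then for every simple right $H$-comodule $S$, the composition length of $E(S)$ satisfies $$\ell(E(S)) \le d \cdot \dim_k E(k).$$ -/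

import Mathlib

open scoped TensorProduct

universe u

/-- A right comodule over a `k`-coalgebra `C`: a `k`-module `M` with a coassociative and counital
coaction `ρ : M → M ⊗ C`. -/
class RightComodule (k C M : Type*) [CommSemiring k] [AddCommMonoid C] [Module k C]
    [Coalgebra k C] [AddCommMonoid M] [Module k M] where
  /-- The coaction. -/
  coact : M →ₗ[k] M ⊗[k] C
  /-- `(ρ ⊗ id) ∘ ρ = (id ⊗ Δ) ∘ ρ`, up to the associativity isomorphism. -/
  coassoc : (TensorProduct.assoc k M C C).toLinearMap ∘ₗ coact.rTensor C ∘ₗ coact =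
    (Coalgebra.comul (R := k) (A := C)).lTensor M ∘ₗ coact
  /-- `(id ⊗ ε) ∘ ρ = id`, up to the isomorphism `M ⊗ k ≃ M`. -/
  counit_coact : (TensorProduct.rid k M).toLinearMap ∘ₗ
    (Coalgebra.counit (R := k) (A := C)).lTensor M ∘ₗ coact = LinearMap.id

/-- The trivial right comodule `k` over a bialgebra, with coaction `a ↦ a ⊗ 1`. -/
instance RightComodule.trivial (k H : Type*) [CommSemiring k] [Semiring H] [Bialgebra k H] :
    RightComodule k H k where
  coact := (TensorProduct.mk k k H).flip 1
  coassoc := by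
    ext
    simp [Algebra.TensorProduct.one_def]
  counit_coact := by
    ext
    simp

section Comodules

variable (k C : Type*) [Field k] [AddCommGroup C] [Module k C] [Coalgebra k C]

/-- Morphisms of right comodules: linear maps commuting with the coactions. -/
def IsComoduleHom {M N : Type*} [AddCommGroup M] [Module k M] [RightComodule k C M]
    [AddCommGroup N] [Module k N] [RightComodule k C N] (f : M →ₗ[k] N) : Prop :=
  RightComodule.coact (C := C) ∘ₗ f = f.rTensor C ∘ₗ RightComodule.coact (C := C)

variable (M : Type*) [AddCommGroup M] [Module k M] [RightComodule k C M]

/-- The subcomodules of `M`, ordered by inclusion: the subspaces `N` with `ρ(N) ⊆ N ⊗ C`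
(over a field, `N ⊗ C` is a subspace of `M ⊗ C`). -/
abbrev Subcomodule : Type _ :=
  {N : Submodule k M //
    ∀ x ∈ N, RightComodule.coact (C := C) x ∈ LinearMap.range (N.subtype.rTensor C)}

instance Subcomodule.instBoundedOrder : BoundedOrder (Subcomodule k C M) where
  top := ⟨⊤, fun x _ => by
    have hs : Function.Surjective ((⊤ : Submodule k M).subtype.rTensor C) :=
      LinearMap.rTensor_surjective C fun y => ⟨⟨y, trivial⟩, rfl⟩
    exact hs _⟩
  le_top N := (le_top : N.1 ≤ ⊤)
  bot := ⟨⊥, fun x hx => by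
    rw [(Submodule.mem_bot k).1 hx, map_zero]
    exact Submodule.zero_mem _⟩
  bot_le N := (bot_le : ⊥ ≤ N.1)

/-- A simple comodule: nonzero, with no subcomodules other than `0` and itself. -/
def IsSimpleComodule : Prop :=
  Nontrivial M ∧ ∀ N : Subcomodule k C M, N = ⊥ ∨ N = ⊤

/-- The composition length of a comodule: the supremum (possibly infinite) of the lengths `n` of
chains `N₀ < N₁ < ⋯ < Nₙ` of subcomodules. -/
noncomputable def comoduleLength : ℕ∞ :=
  Order.height (⊤ : Subcomodule k C M)

/-- The dimensions of the composition factors of `M`, that is, of the quotients `B / A` for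
subcomodules `A < B` of `M` with no subcomodule strictly between them. -/
def compositionFactorDims : Set ℕ :=
  {n | ∃ A B : Subcomodule k C M, A ⋖ B ∧
    Module.finrank k (B.1 ⧸ A.1.submoduleOf B.1) = n}

end Comodules

section Injectives

variable (k C : Type u) [Field k] [AddCommGroup C] [Module k C] [Coalgebra k C]

/-- Injective objects in the category of right comodules. -/
def IsInjectiveComodule (E : Type u) [AddCommGroup E] [Module k E] [RightComodule k C E] : Prop :=
  ∀ (X Y : Type u) [AddCommGroup X] [Module k X] [RightComodule k C X]
    [AddCommGroup Y] [Module k Y] [RightComodule k C Y] (f : X →ₗ[k] Y) (g : X →ₗ[k] E),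
    IsComoduleHom k C f → Function.Injective f → IsComoduleHom k C g →
      ∃ h : Y →ₗ[k] E, IsComoduleHom k C h ∧ h ∘ₗ f = g

/-- `i : M → E` is an injective hull of the comodule `M`: `E` is injective, and `i` is an injective
comodule morphism whose image is essential, i.e. meets every nonzero subcomodule of `E`
nontrivially. -/
structure IsInjectiveHull {M E : Type u} [AddCommGroup M] [Module k M] [RightComodule k C M]
    [AddCommGroup E] [Module k E] [RightComodule k C E] (i : M →ₗ[k] E) : Prop where
  isComoduleHom : IsComoduleHom k C i
  injective : Function.Injective i
  isInjective : IsInjectiveComodule k C E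
  essential : ∀ N : Subcomodule k C E, N.1 ⊓ LinearMap.range i = ⊥ → N = ⊥

end Injectives

section Integrals

variable (k H : Type*) [Field k] [Ring H] [HopfAlgebra k H]

/-- A left integral for `H`: a functional `t` with `∑ t(h₂) h₁ = t(h) 1` for all `h`. -/
def IsLeftIntegral (t : H →ₗ[k] k) : Prop :=
  ∀ h : H, TensorProduct.rid k H (t.lTensor H (Coalgebra.comul h)) = t h • (1 : H)

/-- A right integral for `H`: a functional `t` with `∑ t(h₁) h₂ = t(h) 1` for all `h`. -/
def IsRightIntegral (t : H →ₗ[k] k) : Prop :=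
  ∀ h : H, TensorProduct.lid k H (t.rTensor H (Coalgebra.comul h)) = t h • (1 : H)

/-- A Hopf algebra is co-Frobenius if it has a nonzero integral (left or right). -/
def IsCoFrobenius : Prop :=
  ∃ t : H →ₗ[k] k, t ≠ 0 ∧ (IsLeftIntegral k H t ∨ IsRightIntegral k H t)

end Integrals

/-!
The proof is elementary: it uses neither the bijectivity of the antipode nor the uniqueness of
integrals, only that the antipode is injective. Comments use Sweedler notation; `S(h)`, for an
element `h`, is the antipode, while `S` alone is the simple comodule. Comodules `M` are studied
through their coefficient maps `m ↦ ∑ ξ(m₀) m₁` with values in `H`, where `ξ` is a functional on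
`M`, and through the action `m ↦ ∑ η(m₁) m₀` of functionals `η` on `H`.

A nonzero integral makes the antipode injective (`IsCoFrobenius.antipode_injective`) and provides
a finite rank colinear endomorphism of `H` fixing `1`
(`IsCoFrobenius.exists_finite_range_evalLeft_comul`). Composing it with a coefficient map of `E(k)`
gives a colinear map that is injective on `k`, hence on `E(k)`, so `E(k)` is finite dimensional.

Injectivity of `E(k)` enters only through a colinear map `γ : H → E(k)` extending `k → E(k)`. With
its help `E(S)` embeds in `S ⊗ E(k)`, so that
`dim E(S) ≤ dim S · dim E(k)` (`IsInjectiveHull.finiteDimensional_and_finrank_le`). On the other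
hand, each layer `B / A` of a chain of subcomodules of `E(S)` satisfies `dim S ≤ d · dim (B / A)`
(`IsInjectiveHull.finrank_add_mul_finrank_le`): `S` occurs in the tensor product of `B / A` with
a dual of a composition factor of `E(k)`. A chain of length `n` therefore gives
`n · dim S ≤ d · dim E(S) ≤ d · dim S · dim E(k)`, and `dim S` can be cancelled.
-/

open Coalgebra HopfAlgebra WithConv

/-! ### Subspaces of a tensor product over a field -/

section TensorCriteria

variable {k M C : Type*} [Field k] [AddCommGroup M] [Module k M] [AddCommGroup C] [Module k C]

theorem tensor_eq_zero_of_forall_dual {z : M ⊗[k] C}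
    (h : ∀ ξ : Module.Dual k M, ξ.rTensor C z = 0) : z = 0 := by
  classical
  let b := Module.Basis.ofVectorSpace k M
  apply (TensorProduct.equivFinsuppOfBasisLeft (N := C) b).injective
  ext i
  rw [map_zero]
  have key : ∀ w : M ⊗[k] C, TensorProduct.equivFinsuppOfBasisLeft (N := C) b w i =
      TensorProduct.lid k C ((b.coord i).rTensor C w) := by
    intro w
    induction w with
    | zero => simp
    | tmul m c => simp
    | add x y hx hy => simp only [map_add, Finsupp.add_apply, hx, hy]
  rw [key, h, map_zero, Finsupp.zero_apply]

theorem mem_range_rTensor_subtype_of_forall_dualAnnihilator {N : Submodule k M} {z : M ⊗[k] C}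
    (h : ∀ ξ ∈ N.dualAnnihilator, ξ.rTensor C z = 0) :
    z ∈ LinearMap.range (N.subtype.rTensor C) := by
  have hex : Function.Exact (N.subtype.rTensor C) (N.mkQ.rTensor C) :=
    rTensor_exact C (LinearMap.exact_subtype_mkQ N) N.mkQ_surjective
  refine (hex z).1 (tensor_eq_zero_of_forall_dual fun ξ => ?_)
  rw [← LinearMap.comp_apply, ← LinearMap.rTensor_comp]
  refine h _ ((Submodule.mem_dualAnnihilator _).2 fun n hn => ?_)
  simp [(Submodule.Quotient.mk_eq_zero N).2 hn]

theorem rTensor_eq_zero_of_mem_range {V : Type*} [AddCommGroup V] [Module k V]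
    {N : Submodule k M} {z : M ⊗[k] C} (hz : z ∈ LinearMap.range (N.subtype.rTensor C))
    {f : M →ₗ[k] V} (hf : ∀ x ∈ N, f x = 0) : f.rTensor C z = 0 := by
  obtain ⟨w, rfl⟩ := hz
  rw [← LinearMap.comp_apply, ← LinearMap.rTensor_comp]
  have : f ∘ₗ N.subtype = 0 := by ext x; exact hf x x.2
  simp [this]

theorem lift_eq_zero_of_mem_range {V : Type*} [AddCommGroup V] [Module k V]
    {N : Submodule k M} {z : M ⊗[k] C} (hz : z ∈ LinearMap.range (N.subtype.rTensor C))
    {f : M →ₗ[k] C →ₗ[k] V} (hf : ∀ x ∈ N, f x = 0) : TensorProduct.lift f z = 0 := by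
  have h : ∀ z : M ⊗[k] C, TensorProduct.lift f z =
      TensorProduct.lift LinearMap.id (f.rTensor C z) := by
    intro z
    induction z with
    | zero => simp
    | tmul a b => simp
    | add x y hx hy => simp only [map_add, hx, hy]
  rw [h, rTensor_eq_zero_of_mem_range hz hf, map_zero]

theorem mem_range_rTensor_subtype_of_forall_lTensor {N : Submodule k M} {z : M ⊗[k] C}
    (h : ∀ η : Module.Dual k C, TensorProduct.rid k M (η.lTensor M z) ∈ N) :
    z ∈ LinearMap.range (N.subtype.rTensor C) := by
  refine mem_range_rTensor_subtype_of_forall_dualAnnihilator fun ξ hξ => ?_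
  have hc : TensorProduct.lid k C (ξ.rTensor C z) = 0 := by
    refine (Module.forall_dual_apply_eq_zero_iff k _).1 fun η => ?_
    have key : ∀ w : M ⊗[k] C, η (TensorProduct.lid k C (ξ.rTensor C w)) =
        ξ (TensorProduct.rid k M (η.lTensor M w)) := by
      intro w
      induction w with
      | zero => simp
      | tmul m c => simp [mul_comm]
      | add x y hx hy => simp only [map_add, hx, hy]
    rw [key]
    exact (Submodule.mem_dualAnnihilator _).1 hξ _ (h η)
  simpa using hc

end TensorCriteria

/-! ### Convolution identities for the antipode -/

section Convolution

variable {k H : Type*} [Field k] [Ring H] [HopfAlgebra k H]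

theorem toConv_algHom_mul_antipode {A : Type*} [Ring A] [Algebra k A] (f : H →ₐ[k] A) :
    toConv f.toLinearMap * toConv (f.toLinearMap ∘ₗ antipode k) = 1 := by
  have h := LinearMap.algHom_comp_convMul_distrib f (toConv LinearMap.id)
    (toConv (antipode k (A := H)))
  rw [LinearMap.id_mul_antipode] at h
  apply WithConv.ofConv_injective
  refine Eq.trans h.symm ?_
  ext x
  simp [LinearMap.convOne_def]

theorem toConv_antipode_mul_algHom {A : Type*} [Ring A] [Algebra k A] (f : H →ₐ[k] A) :
    toConv (f.toLinearMap ∘ₗ antipode k) * toConv f.toLinearMap = 1 := by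
  have h := LinearMap.algHom_comp_convMul_distrib f (toConv (antipode k (A := H)))
    (toConv LinearMap.id)
  rw [LinearMap.antipode_mul_id] at h
  apply WithConv.ofConv_injective
  refine Eq.trans h.symm ?_
  ext x
  simp [LinearMap.convOne_def]

open Algebra.TensorProduct in
theorem toConv_includeLeft_mul_includeRight :
    toConv (includeLeft (R := k) (S := k) (A := H) (B := H)).toLinearMap *
      toConv (includeRight (R := k) (A := H) (B := H)).toLinearMap =
      toConv (Bialgebra.comulAlgHom k H).toLinearMap := by
  ext c
  rw [(ℛ k c).convMul_apply]
  simpa using (ℛ k c).eq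

open Algebra.TensorProduct in
/-- The antipode reverses the comultiplication: `Δ = ι₁ * ι₂` for the two inclusions `H → H ⊗ H`,
and composing an algebra map with the antipode gives its convolution inverse. -/
theorem toConv_comul_comp_antipode :
    toConv ((Bialgebra.comulAlgHom k H).toLinearMap ∘ₗ antipode k) =
      toConv ((includeRight (R := k) (A := H) (B := H)).toLinearMap ∘ₗ antipode k) *
      toConv ((includeLeft (R := k) (S := k) (A := H) (B := H)).toLinearMap ∘ₗ antipode k) := by
  refine left_inv_eq_right_inv (toConv_antipode_mul_algHom (Bialgebra.comulAlgHom k H)) ?_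
  rw [← toConv_includeLeft_mul_includeRight, mul_assoc,
    ← mul_assoc (toConv includeRight.toLinearMap), toConv_algHom_mul_antipode,
    one_mul, toConv_algHom_mul_antipode]

variable {c : H} {ι : Type*} (r : Coalgebra.Repr k c ι)

theorem sum_antipode_tmul_one_mul_comul :
    ∑ i ∈ r.index, (antipode k (r.left i) ⊗ₜ[k] (1 : H)) * comul (R := k) (r.right i) =
      1 ⊗ₜ c := by
  have h : toConv ((Algebra.TensorProduct.includeLeft (R := k) (S := k) (A := H)
      (B := H)).toLinearMap ∘ₗ antipode k) * toConv (Bialgebra.comulAlgHom k H).toLinearMap =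
      toConv (Algebra.TensorProduct.includeRight (R := k) (A := H) (B := H)).toLinearMap := by
    rw [← toConv_includeLeft_mul_includeRight, ← mul_assoc, toConv_antipode_mul_algHom, one_mul]
  have := congr($h c)
  rw [r.convMul_apply] at this
  simpa using this

theorem sum_comul_mul_one_tmul_antipode :
    ∑ i ∈ r.index, comul (R := k) (r.left i) * ((1 : H) ⊗ₜ[k] antipode k (r.right i)) =
      c ⊗ₜ 1 := by
  have h : toConv (Bialgebra.comulAlgHom k H).toLinearMap *
      toConv ((Algebra.TensorProduct.includeRight (R := k) (A := H)
        (B := H)).toLinearMap ∘ₗ antipode k) =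
      toConv (Algebra.TensorProduct.includeLeft (R := k) (S := k) (A := H)
        (B := H)).toLinearMap := by
    rw [← toConv_includeLeft_mul_includeRight, mul_assoc, toConv_algHom_mul_antipode, mul_one]
  have := congr($h c)
  rw [r.convMul_apply] at this
  simpa using this

theorem sum_comul_antipode_mul_tmul_one :
    ∑ i ∈ r.index, comul (R := k) (antipode k (r.left i)) * (r.right i ⊗ₜ[k] (1 : H)) =
      1 ⊗ₜ antipode k c := by
  have h : toConv ((Bialgebra.comulAlgHom k H).toLinearMap ∘ₗ antipode k) *
      toConv (Algebra.TensorProduct.includeLeft (R := k) (S := k) (A := H) (B := H)).toLinearMap =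
      toConv ((Algebra.TensorProduct.includeRight (R := k) (A := H)
        (B := H)).toLinearMap ∘ₗ antipode k) := by
    rw [toConv_comul_comp_antipode, mul_assoc, toConv_antipode_mul_algHom, mul_one]
  have := congr($h c)
  rw [r.convMul_apply] at this
  simpa using this

theorem sum_one_tmul_mul_comul_antipode :
    ∑ i ∈ r.index, ((1 : H) ⊗ₜ[k] r.left i) * comul (R := k) (antipode k (r.right i)) =
      antipode k c ⊗ₜ 1 := by
  have h : toConv (Algebra.TensorProduct.includeRight (R := k) (A := H) (B := H)).toLinearMap *
      toConv ((Bialgebra.comulAlgHom k H).toLinearMap ∘ₗ antipode k) =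
      toConv ((Algebra.TensorProduct.includeLeft (R := k) (S := k) (A := H)
        (B := H)).toLinearMap ∘ₗ antipode k) := by
    rw [toConv_comul_comp_antipode, ← mul_assoc, toConv_algHom_mul_antipode, one_mul]
  have := congr($h c)
  rw [r.convMul_apply] at this
  simpa using this

theorem comul_antipode_eq_sum :
    comul (R := k) (antipode k c) =
      ∑ i ∈ r.index, antipode k (r.right i) ⊗ₜ[k] antipode k (r.left i) := by
  have := congr($(toConv_comul_comp_antipode (k := k) (H := H)) c)
  rw [r.convMul_apply] at this
  simpa using this

end Convolution

/-! ### Contracting one tensor factor -/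

section LeftRight

variable {k : Type*} (H : Type*) [Field k] [Ring H] [Algebra k H]

/-- The map `a ⊗ b ↦ t(b) a`. -/
noncomputable def evalRight (t : Module.Dual k H) : H ⊗[k] H →ₗ[k] H :=
  (TensorProduct.rid k H).toLinearMap ∘ₗ t.lTensor H

/-- The map `a ⊗ b ↦ t(a) b`. -/
noncomputable def evalLeft (t : Module.Dual k H) : H ⊗[k] H →ₗ[k] H :=
  (TensorProduct.lid k H).toLinearMap ∘ₗ t.rTensor H

variable {H} (t : Module.Dual k H)

@[simp] theorem evalRight_tmul (a b : H) : evalRight H t (a ⊗ₜ b) = t b • a := by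
  simp [evalRight]

@[simp] theorem evalLeft_tmul (a b : H) : evalLeft H t (a ⊗ₜ b) = t a • b := by
  simp [evalLeft]

theorem evalRight_tmul_one_mul (a : H) (X : H ⊗[k] H) :
    evalRight H t ((a ⊗ₜ 1) * X) = a * evalRight H t X := by
  induction X with
  | zero => simp
  | tmul x y => simp
  | add x y hx hy => simp only [mul_add, map_add, hx, hy]

theorem evalRight_mul_tmul_one (a : H) (X : H ⊗[k] H) :
    evalRight H t (X * (a ⊗ₜ 1)) = evalRight H t X * a := by
  induction X with
  | zero => simp
  | tmul x y => simp
  | add x y hx hy => simp only [add_mul, map_add, hx, hy]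

theorem evalLeft_one_tmul_mul (a : H) (X : H ⊗[k] H) :
    evalLeft H t ((1 ⊗ₜ a) * X) = a * evalLeft H t X := by
  induction X with
  | zero => simp
  | tmul x y => simp
  | add x y hx hy => simp only [mul_add, map_add, hx, hy]

theorem evalLeft_mul_one_tmul (a : H) (X : H ⊗[k] H) :
    evalLeft H t (X * (1 ⊗ₜ a)) = evalLeft H t X * a := by
  induction X with
  | zero => simp
  | tmul x y => simp
  | add x y hx hy => simp only [add_mul, map_add, hx, hy]

theorem dual_evalRight (η : Module.Dual k H) (X : H ⊗[k] H) :
    η (evalRight H t X) = t (evalLeft H η X) := by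
  induction X with
  | zero => simp
  | tmul x y => simp [mul_comm]
  | add x y hx hy => simp only [map_add, hx, hy]

end LeftRight

/-! ### Consequences of a nonzero integral -/

section Integrals

variable {k H : Type*} [Field k] [Ring H] [HopfAlgebra k H]

theorem IsLeftIntegral.evalRight_comul {t : H →ₗ[k] k} (ht : IsLeftIntegral k H t) (h : H) :
    evalRight H t (comul h) = t h • (1 : H) := ht h

theorem IsRightIntegral.evalLeft_comul {t : H →ₗ[k] k} (ht : IsRightIntegral k H t) (h : H) :
    evalLeft H t (comul h) = t h • (1 : H) := ht h

/-- If `Δ(h) ∈ L ⊗ H` and the counit vanishes on `L`, then `h = ∑ ε(h₁) h₂` is zero. -/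
theorem eq_zero_of_comul_mem_range {L : Submodule k H} (hε : ∀ h ∈ L, counit (R := k) h = 0)
    {h : H} (hh : comul (R := k) h ∈ LinearMap.range (L.subtype.rTensor H)) : h = 0 := by
  have := Coalgebra.rTensor_counit_comul (R := k) h
  rw [rTensor_eq_zero_of_mem_range hh hε] at this
  simpa using congr(TensorProduct.lid k H $this.symm)

/-- If `Δ(h) ∈ H ⊗ L` and the counit vanishes on `L`, then `h = ∑ ε(h₂) h₁` is zero. -/
theorem eq_zero_of_comm_comul_mem_range {L : Submodule k H}
    (hε : ∀ h ∈ L, counit (R := k) h = 0) {h : H}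
    (hh : TensorProduct.comm k H H (comul (R := k) h) ∈
      LinearMap.range (L.subtype.rTensor H)) : h = 0 := by
  have := Coalgebra.lTensor_counit_comul (R := k) h
  have hcomm : ∀ z : H ⊗[k] H, (counit (R := k)).rTensor H (TensorProduct.comm k H H z) =
      TensorProduct.comm k H k ((counit (R := k)).lTensor H z) := by
    intro z
    induction z with
    | zero => simp
    | tmul a b => simp
    | add x y hx hy => simp only [map_add, hx, hy]
  have h2 := rTensor_eq_zero_of_mem_range hh hε
  rw [hcomm, this] at h2
  simpa using congr(TensorProduct.lid k H $h2)

/-- A nonzero left integral `t` makes the antipode injective: the elements `h` with `t(x S(h)) = 0`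
for all `x` form a right coideal which contains the kernel of the antipode and lies in
the kernel of the counit. -/
theorem IsLeftIntegral.antipode_injective {t : H →ₗ[k] k} (ht : IsLeftIntegral k H t)
    (h0 : t ≠ 0) : Function.Injective (antipode k (A := H)) := by
  obtain ⟨u, hu⟩ : ∃ u, t u ≠ 0 := by
    by_contra! h
    exact h0 (LinearMap.ext h)
  let L : Submodule k H :=
    { carrier := {h | ∀ x, t (x * antipode k h) = 0}
      add_mem' := fun {a b} ha hb x => by rw [map_add, mul_add, map_add, ha, hb, add_zero]
      zero_mem' := fun x => by simp
      smul_mem' := fun c a ha x => by simp [ha x] }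
  -- `∑ x₁ t(x₂ S(h)) = ∑ t(x S(h₁)) h₂`, so `L` is a right coideal.
  have hL : ∀ h ∈ L, comul (R := k) h ∈ LinearMap.range (L.subtype.rTensor H) := by
    intro h hh
    refine mem_range_rTensor_subtype_of_forall_lTensor fun η x => ?_
    have e1 : evalRight H t (comul (R := k) x * (1 ⊗ₜ antipode k h)) =
        ∑ i ∈ (ℛ k h).index, t (x * antipode k ((ℛ k h).left i)) • (ℛ k h).right i := by
      rw [← sum_comul_antipode_mul_tmul_one (ℛ k h), Finset.mul_sum, map_sum]
      refine Finset.sum_congr rfl fun i _ => ?_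
      rw [← mul_assoc, ← Bialgebra.comul_mul, evalRight_mul_tmul_one, ht.evalRight_comul,
        smul_one_mul]
    have e2 : evalRight H t (comul (R := k) x * (1 ⊗ₜ antipode k h)) = 0 := by
      rw [← (ℛ k x).eq, Finset.sum_mul, map_sum]
      exact Finset.sum_eq_zero fun i _ => by simp [hh _]
    rw [e2] at e1
    have e3 := congr(η $e1)
    rw [← (ℛ k h).eq]
    simpa [map_sum, Finset.mul_sum, mul_comm] using e3.symm
  have hε : ∀ h ∈ L, counit (R := k) h = 0 := by
    intro h hh
    let f : H →ₗ[k] H →ₗ[k] k := LinearMap.mk₂ k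
      (fun a b => t (u * (antipode k (antipode k b) * antipode k a)))
      (by intros; simp [mul_add]) (by intros; simp)
      (by intros; simp [mul_add, add_mul]) (by intros; simp)
    have e1 : TensorProduct.lift f (comul (R := k) h) = 0 := by
      refine lift_eq_zero_of_mem_range (hL h hh) fun a ha => ?_
      ext b
      simpa [f, mul_assoc] using ha (u * antipode k (antipode k b))
    -- `∑ S(S(h₂)) S(h₁) = S(∑ h₁ S(h₂)) = ε(h) 1`
    have e2 : TensorProduct.lift f (comul (R := k) h) = counit (R := k) h * t u := by
      have := congrArg (fun z => t (u * antipode k z)) (sum_mul_antipode_eq_smul (R := k) (ℛ k h))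
      nth_rewrite 1 [← (ℛ k h).eq]
      simpa [map_sum, Finset.mul_sum, f, antipode_mul_antidistrib] using this
    rw [e1] at e2
    exact (mul_eq_zero.1 e2.symm).resolve_right hu
  rw [← LinearMap.ker_eq_bot, LinearMap.ker_eq_bot']
  intro h hh
  exact eq_zero_of_comul_mem_range hε (hL h fun x => by simp [hh])

/-- The mirror image of `IsLeftIntegral.antipode_injective`, with the left coideal of the elements
`h` such that `t(S(h) x) = 0` for all `x`. -/
theorem IsRightIntegral.antipode_injective {t : H →ₗ[k] k} (ht : IsRightIntegral k H t)
    (h0 : t ≠ 0) : Function.Injective (antipode k (A := H)) := by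
  obtain ⟨u, hu⟩ : ∃ u, t u ≠ 0 := by
    by_contra! h
    exact h0 (LinearMap.ext h)
  let L : Submodule k H :=
    { carrier := {h | ∀ x, t (antipode k h * x) = 0}
      add_mem' := fun {a b} ha hb x => by rw [map_add, add_mul, map_add, ha, hb, add_zero]
      zero_mem' := fun x => by simp
      smul_mem' := fun c a ha x => by simp [ha x] }
  -- `∑ t(S(h) x₁) x₂ = ∑ h₁ t(S(h₂) x)`, so `L` is a left coideal.
  have hL : ∀ h ∈ L, TensorProduct.comm k H H (comul (R := k) h) ∈
      LinearMap.range (L.subtype.rTensor H) := by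
    intro h hh
    refine mem_range_rTensor_subtype_of_forall_lTensor fun η x => ?_
    have e1 : evalLeft H t ((antipode k h ⊗ₜ 1) * comul (R := k) x) =
        ∑ i ∈ (ℛ k h).index, t (antipode k ((ℛ k h).right i) * x) • (ℛ k h).left i := by
      rw [← sum_one_tmul_mul_comul_antipode (ℛ k h), Finset.sum_mul, map_sum]
      refine Finset.sum_congr rfl fun i _ => ?_
      rw [mul_assoc, ← Bialgebra.comul_mul, evalLeft_one_tmul_mul, ht.evalLeft_comul,
        mul_smul_one]
    have e2 : evalLeft H t ((antipode k h ⊗ₜ 1) * comul (R := k) x) = 0 := by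
      rw [← (ℛ k x).eq, Finset.mul_sum, map_sum]
      exact Finset.sum_eq_zero fun i _ => by simp [hh _]
    rw [e2] at e1
    have e3 := congr(η $e1)
    rw [← (ℛ k h).eq]
    simpa [map_sum, Finset.sum_mul, mul_comm] using e3.symm
  have hε : ∀ h ∈ L, counit (R := k) h = 0 := by
    intro h hh
    let f : H →ₗ[k] H →ₗ[k] k := LinearMap.mk₂ k
      (fun a b => t (antipode k a * antipode k (antipode k b) * u))
      (by intros; simp [add_mul]) (by intros; simp)
      (by intros; simp [mul_add, add_mul]) (by intros; simp)
    have e1 : TensorProduct.lift f (TensorProduct.comm k H H (comul (R := k) h)) = 0 := by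
      refine lift_eq_zero_of_mem_range (hL h hh) fun a ha => ?_
      ext b
      simpa [f, mul_assoc] using ha (antipode k (antipode k b) * u)
    -- `∑ S(h₂) S(S(h₁)) = S(∑ S(h₁) h₂) = ε(h) 1`
    have e2 : TensorProduct.lift f (TensorProduct.comm k H H (comul (R := k) h)) =
        counit (R := k) h * t u := by
      have := congrArg (fun z => t (antipode k z * u)) (sum_antipode_mul_eq_smul (R := k) (ℛ k h))
      nth_rewrite 1 [← (ℛ k h).eq]
      simpa [map_sum, Finset.sum_mul, f, antipode_mul_antidistrib] using this
    rw [e1] at e2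
    exact (mul_eq_zero.1 e2.symm).resolve_right hu
  rw [← LinearMap.ker_eq_bot, LinearMap.ker_eq_bot']
  intro h hh
  exact eq_zero_of_comm_comul_mem_range hε (hL h fun x => by simp [hh])

theorem IsCoFrobenius.antipode_injective (hH : IsCoFrobenius k H) :
    Function.Injective (antipode k (A := H)) := by
  obtain ⟨t, h0, ht | ht⟩ := hH
  · exact ht.antipode_injective h0
  · exact ht.antipode_injective h0

/-- A co-Frobenius Hopf algebra has a functional `τ` with `τ(1) = 1` for which the right colinear
endomorphism `h ↦ ∑ τ(h₁) h₂` has finite rank: `τ = t(· u)` for a right integral `t`, and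
`τ = t(u S(·))` for a left integral `t`, where `t(u) = 1`. In the second case it is the composite
with the antipode that is seen to have finite rank, and the antipode is injective. -/
theorem IsCoFrobenius.exists_finite_range_evalLeft_comul (hH : IsCoFrobenius k H) :
    ∃ τ : Module.Dual k H, τ 1 = 1 ∧
      FiniteDimensional k (LinearMap.range (evalLeft H τ ∘ₗ comul)) := by
  have hS := hH.antipode_injective
  obtain ⟨t, h0, ht⟩ := hH
  obtain ⟨u, hu⟩ : ∃ u, t u = 1 := by
    obtain ⟨u, hu⟩ : ∃ u, t u ≠ 0 := by
      by_contra! h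
      exact h0 (LinearMap.ext h)
    exact ⟨(t u)⁻¹ • u, by simp [hu]⟩
  rcases ht with ht | ht
  · refine ⟨t ∘ₗ LinearMap.mulLeft k u ∘ₗ antipode k, by simpa using hu, ?_⟩
    set q := evalLeft H (t ∘ₗ LinearMap.mulLeft k u ∘ₗ antipode k) ∘ₗ comul with hq
    -- `S(q(x)) = ∑ S(u₁) t(u₂ S(x))`
    have key : ∀ x, antipode k (q x) =
        ∑ i ∈ (ℛ k u).index, t ((ℛ k u).right i * antipode k x) • antipode k ((ℛ k u).left i) := by
      intro x
      have e1 : antipode k (q x) =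
          evalRight H t ((1 ⊗ₜ u) * comul (R := k) (antipode k x)) := by
        rw [comul_antipode_eq_sum (ℛ k x), hq, LinearMap.comp_apply]
        nth_rewrite 1 [← (ℛ k x).eq]
        simp [map_sum, Finset.mul_sum]
      rw [e1, ← sum_antipode_tmul_one_mul_comul (ℛ k u), Finset.sum_mul, map_sum]
      refine Finset.sum_congr rfl fun i _ => ?_
      rw [mul_assoc, ← Bialgebra.comul_mul, evalRight_tmul_one_mul, ht.evalRight_comul,
        mul_smul_one]
    let V := Submodule.span k ((fun i => antipode k ((ℛ k u).left i)) '' ((ℛ k u).index : Set _))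
    have hV : FiniteDimensional k V :=
      FiniteDimensional.span_of_finite k ((Finset.finite_toSet _).image _)
    have hmem : ∀ z ∈ LinearMap.range q, antipode k z ∈ V := by
      rintro _ ⟨x, rfl⟩
      rw [key]
      exact Submodule.sum_mem _ fun i hi => Submodule.smul_mem _ _
        (Submodule.subset_span ⟨i, hi, rfl⟩)
    exact FiniteDimensional.of_injective ((antipode k (A := H)).restrict hmem)
      (fun a b hab => Subtype.ext (hS (congrArg Subtype.val hab)))
  · refine ⟨t ∘ₗ LinearMap.mulRight k u, by simpa using hu, ?_⟩
    set q := evalLeft H (t ∘ₗ LinearMap.mulRight k u) ∘ₗ comul with hq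
    -- `q(x) = ∑ t(x u₁) S(u₂)`
    have key : ∀ x, q x =
        ∑ i ∈ (ℛ k u).index, t (x * (ℛ k u).left i) • antipode k ((ℛ k u).right i) := by
      intro x
      have e1 : q x = evalLeft H t (comul (R := k) x * (u ⊗ₜ 1)) := by
        rw [hq, LinearMap.comp_apply, ← (ℛ k x).eq]
        simp [map_sum, Finset.sum_mul]
      rw [e1, ← sum_comul_mul_one_tmul_antipode (ℛ k u), Finset.mul_sum, map_sum]
      refine Finset.sum_congr rfl fun i _ => ?_
      rw [← mul_assoc, ← Bialgebra.comul_mul, evalLeft_mul_one_tmul, ht.evalLeft_comul,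
        smul_one_mul]
    let V := Submodule.span k ((fun i => antipode k ((ℛ k u).right i)) '' ((ℛ k u).index : Set _))
    have hV : FiniteDimensional k V :=
      FiniteDimensional.span_of_finite k ((Finset.finite_toSet _).image _)
    refine Submodule.finiteDimensional_of_le (S₂ := V) ?_
    rintro _ ⟨x, rfl⟩
    rw [key]
    exact Submodule.sum_mem _ fun i hi => Submodule.smul_mem _ _
      (Submodule.subset_span ⟨i, hi, rfl⟩)

end Integrals

/-! ### Coefficient maps and the dual action on a comodule -/

section Coefficients

variable {k : Type*} (C : Type*) {M N : Type*} [Field k] [AddCommGroup C] [Module k C]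
  [Coalgebra k C] [AddCommGroup M] [Module k M] [RightComodule k C M]
  [AddCommGroup N] [Module k N] [RightComodule k C N]

/-- The coefficient map `m ↦ ∑ ξ(m₀) m₁` attached to a functional `ξ` on a right comodule. -/
noncomputable def comoduleCoeff (ξ : Module.Dual k M) : M →ₗ[k] C :=
  (TensorProduct.lid k C).toLinearMap ∘ₗ ξ.rTensor C ∘ₗ RightComodule.coact (C := C)

/-- The action `m ↦ ∑ η(m₁) m₀` on a right comodule of a functional `η` on the coalgebra. -/
noncomputable def dualAct (η : Module.Dual k C) : M →ₗ[k] M :=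
  (TensorProduct.rid k M).toLinearMap ∘ₗ η.lTensor M ∘ₗ RightComodule.coact (C := C)

variable {C}

theorem coact_coassoc_apply (m : M) :
    TensorProduct.assoc k M C C
      ((RightComodule.coact (k := k) (C := C) (M := M)).rTensor C (RightComodule.coact m)) =
      (comul (R := k) (A := C)).lTensor M (RightComodule.coact m) :=
  congr($(RightComodule.coassoc (k := k) (C := C) (M := M)) m)

theorem dual_comoduleCoeff (ξ : Module.Dual k M) (η : Module.Dual k C) (m : M) :
    η (comoduleCoeff C ξ m) = ξ (dualAct C η m) := by
  have key : ∀ w : M ⊗[k] C, η (TensorProduct.lid k C (ξ.rTensor C w)) =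
      ξ (TensorProduct.rid k M (η.lTensor M w)) := by
    intro w
    induction w with
    | zero => simp
    | tmul m c => simp [mul_comm]
    | add x y hx hy => simp only [map_add, hx, hy]
  exact key _

theorem dualAct_counit (m : M) : dualAct C (counit (R := k)) m = m :=
  congr($(RightComodule.counit_coact (k := k) (C := C) (M := M)) m)

theorem counit_comoduleCoeff (ξ : Module.Dual k M) (m : M) :
    counit (R := k) (comoduleCoeff C ξ m) = ξ m := by
  rw [dual_comoduleCoeff, dualAct_counit]

theorem comul_comoduleCoeff (ξ : Module.Dual k M) (m : M) :
    comul (R := k) (comoduleCoeff C ξ m) =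
      (comoduleCoeff C ξ).rTensor C (RightComodule.coact m) := by
  have h := congr((TensorProduct.lid k (C ⊗[k] C)) (ξ.rTensor (C ⊗[k] C) $(coact_coassoc_apply m)))
  have h1 : ∀ z : M ⊗[k] C, (TensorProduct.lid k (C ⊗[k] C)) (ξ.rTensor (C ⊗[k] C)
      ((comul (R := k) (A := C)).lTensor M z)) =
      comul (R := k) (TensorProduct.lid k C (ξ.rTensor C z)) := by
    intro z
    induction z with
    | zero => simp
    | tmul a b => simp
    | add x y hx hy => simp only [map_add, hx, hy]
  have h2 : ∀ z : (M ⊗[k] C) ⊗[k] C, (TensorProduct.lid k (C ⊗[k] C)) (ξ.rTensor (C ⊗[k] C)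
      (TensorProduct.assoc k M C C z)) =
      ((TensorProduct.lid k C).toLinearMap ∘ₗ ξ.rTensor C).rTensor C z := by
    intro z
    induction z with
    | zero => simp
    | tmul w c =>
      induction w with
      | zero => simp
      | tmul a b => simp [TensorProduct.smul_tmul']
      | add x y hx hy => simp only [TensorProduct.add_tmul, map_add, hx, hy]
    | add x y hx hy => simp only [map_add, hx, hy]
  rw [h1, h2, ← LinearMap.comp_apply, ← LinearMap.rTensor_comp] at h
  exact h.symm

theorem map_dualAct {V : Type*} [AddCommGroup V] [Module k V] (f : M →ₗ[k] V)
    (η : Module.Dual k C) (m : M) :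
    f (dualAct C η m) =
      TensorProduct.rid k V (η.lTensor V (f.rTensor C (RightComodule.coact m))) := by
  have key : ∀ w : M ⊗[k] C, f (TensorProduct.rid k M (η.lTensor M w)) =
      TensorProduct.rid k V (η.lTensor V (f.rTensor C w)) := by
    intro w
    induction w with
    | zero => simp
    | tmul m c => simp
    | add x y hx hy => simp only [map_add, hx, hy]
  exact key _

theorem comoduleCoeff_dualAct (ξ : Module.Dual k M) (η : Module.Dual k C) (m : M) :
    comoduleCoeff C ξ (dualAct C η m) =
      TensorProduct.rid k C (η.lTensor C (comul (R := k) (comoduleCoeff C ξ m))) := by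
  rw [map_dualAct, comul_comoduleCoeff]

theorem comoduleCoeff_comp_dualAct (ξ : Module.Dual k M) (η : Module.Dual k C) (m : M) :
    comoduleCoeff C (ξ ∘ₗ dualAct C η) m =
      TensorProduct.lid k C (η.rTensor C (comul (R := k) (comoduleCoeff C ξ m))) := by
  have key : ∀ w : M ⊗[k] C, TensorProduct.lid k C ((ξ ∘ₗ dualAct C η).rTensor C w) =
      TensorProduct.lid k C (η.rTensor C ((comoduleCoeff C ξ).rTensor C w)) := by
    intro w
    induction w with
    | zero => simp
    | tmul m c => simp [dual_comoduleCoeff]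
    | add x y hx hy => simp only [map_add, hx, hy]
  rw [comul_comoduleCoeff, ← key]
  rfl

theorem IsComoduleHom.coact_apply {f : M →ₗ[k] N} (hf : IsComoduleHom k C f) (m : M) :
    RightComodule.coact (C := C) (f m) = f.rTensor C (RightComodule.coact (k := k) m) :=
  congr($hf m)

theorem IsComoduleHom.dualAct_apply {f : M →ₗ[k] N} (hf : IsComoduleHom k C f)
    (η : Module.Dual k C) (m : M) : dualAct C η (f m) = f (dualAct C η m) := by
  rw [map_dualAct, ← hf.coact_apply]
  rfl

variable (C)

/-- A subspace stable under the action of the dual algebra is a subcomodule. -/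
def Subcomodule.ofDualAct (N : Submodule k M)
    (h : ∀ x ∈ N, ∀ η : Module.Dual k C, dualAct C η x ∈ N) : Subcomodule k C M :=
  ⟨N, fun x hx => mem_range_rTensor_subtype_of_forall_lTensor fun η => h x hx η⟩

variable {C}

theorem Subcomodule.dualAct_mem (N : Subcomodule k C M) {x : M} (hx : x ∈ N.1)
    (η : Module.Dual k C) : dualAct C η x ∈ N.1 := by
  obtain ⟨w, hw⟩ := N.2 x hx
  have key : ∀ w : N.1 ⊗[k] C,
      TensorProduct.rid k M (η.lTensor M (N.1.subtype.rTensor C w)) ∈ N.1 := by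
    intro w
    induction w with
    | zero => simp
    | tmul m c => simpa using N.1.smul_mem _ m.2
    | add x y hx hy => simpa only [map_add] using N.1.add_mem hx hy
  have := key w
  rw [hw] at this
  exact this

theorem Subcomodule.comoduleCoeff_eq_zero (N : Subcomodule k C M) {x : M} (hx : x ∈ N.1)
    {ξ : Module.Dual k M} (hξ : ∀ y ∈ N.1, ξ y = 0) : comoduleCoeff C ξ x = 0 := by
  simp [comoduleCoeff, rTensor_eq_zero_of_mem_range (N.2 x hx) hξ]

/-- A simple comodule is finite dimensional, being generated by any of its nonzero elements `s`:
it is the image of `η ↦ ∑ η(s₁) s₀`. -/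
theorem IsSimpleComodule.finiteDimensional (hM : IsSimpleComodule k C M) :
    FiniteDimensional k M := by
  obtain ⟨hnt, hs⟩ := hM
  obtain ⟨s, hs0⟩ := exists_ne (0 : M)
  let F : Module.Dual k C →ₗ[k] M :=
    { toFun := fun η => dualAct C η s
      map_add' := fun a b => by simp [dualAct, LinearMap.lTensor_add]
      map_smul' := fun a b => by simp [dualAct, LinearMap.lTensor_smul] }
  have hfin : FiniteDimensional k (LinearMap.range F) := by
    obtain ⟨w, hw⟩ := TensorProduct.exists_finset (RightComodule.coact (k := k) (C := C) s)
    let V := Submodule.span k (Prod.fst '' (w : Set (M × C)))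
    have hV : FiniteDimensional k V :=
      FiniteDimensional.span_of_finite k ((Finset.finite_toSet _).image _)
    refine Submodule.finiteDimensional_of_le (S₂ := V) ?_
    rintro _ ⟨η, rfl⟩
    have : F η = ∑ i ∈ w, η i.2 • i.1 := by
      simp [F, dualAct, hw]
    rw [this]
    exact Submodule.sum_mem _ fun i hi => Submodule.smul_mem _ _
      (Submodule.subset_span ⟨i, hi, rfl⟩)
  -- a functional `ξ` vanishes on the image of `F` exactly when the coefficient `∑ ξ(s₀) s₁` is zero
  have hstab : ∀ x ∈ LinearMap.range F, ∀ η : Module.Dual k C,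
      dualAct C η x ∈ LinearMap.range F := by
    rintro _ ⟨θ, rfl⟩ η
    refine (Subspace.forall_mem_dualAnnihilator_apply_eq_zero_iff _ _).1 fun ξ hξ => ?_
    have h0 : comoduleCoeff C ξ s = 0 := by
      refine (Module.forall_dual_apply_eq_zero_iff k _).1 fun η' => ?_
      rw [dual_comoduleCoeff]
      exact (Submodule.mem_dualAnnihilator _).1 hξ _ ⟨η', rfl⟩
    change ξ (dualAct C η (dualAct C θ s)) = 0
    rw [← dual_comoduleCoeff, comoduleCoeff_dualAct, h0]
    simp
  rcases hs (Subcomodule.ofDualAct C _ hstab) with h | h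
  · refine absurd ?_ hs0
    have : s ∈ (Subcomodule.ofDualAct C _ hstab).1 := ⟨counit, dualAct_counit s⟩
    rw [h] at this
    exact this
  · have : LinearMap.range F = ⊤ := congr($h.1)
    rw [this] at hfin
    exact Module.finite_def.2 (Module.Finite.iff_fg.1 hfin)

end Coefficients

/-! ### Essential extensions and the injective hull of the trivial comodule -/

section Coinvariants

variable {k H M : Type*} [Field k] [Ring H] [HopfAlgebra k H] [AddCommGroup M] [Module k M]
  [RightComodule k H M] {i : k →ₗ[k] M}

theorem IsComoduleHom.coact_map_one (hi : IsComoduleHom k H i) :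
    RightComodule.coact (C := H) (i 1) = i 1 ⊗ₜ[k] (1 : H) := by
  rw [hi.coact_apply]
  simp [RightComodule.coact]

theorem IsComoduleHom.comoduleCoeff_map_one (hi : IsComoduleHom k H i) (ξ : Module.Dual k M) :
    comoduleCoeff H ξ (i 1) = ξ (i 1) • 1 := by
  simp [comoduleCoeff, hi.coact_map_one]

end Coinvariants

section Essential

variable {k C : Type u} [Field k] [AddCommGroup C] [Module k C] [Coalgebra k C]
  {M E : Type u} [AddCommGroup M] [Module k M] [RightComodule k C M]
  [AddCommGroup E] [Module k E] [RightComodule k C E] {i : M →ₗ[k] E}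

/-- The socle of the injective hull of a simple comodule `M` is `M`: every nonzero subcomodule
contains it. -/
theorem IsInjectiveHull.range_le (hi : IsInjectiveHull k C i) (hM : IsSimpleComodule k C M)
    (N : Subcomodule k C E) (hN : N ≠ ⊥) : LinearMap.range i ≤ N.1 := by
  let P : Subcomodule k C M := Subcomodule.ofDualAct C (N.1.comap i) fun x hx η => by
    rw [Submodule.mem_comap, ← hi.isComoduleHom.dualAct_apply]
    exact N.dualAct_mem hx η
  rcases hM.2 P with h | h
  · refine absurd (hi.essential N ?_) hN
    rw [Submodule.eq_bot_iff]
    rintro _ ⟨hx, m, rfl⟩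
    have hm : m ∈ P.1 := hx
    rw [h] at hm
    rw [(Submodule.mem_bot k).1 hm, map_zero]
  · rintro _ ⟨m, rfl⟩
    have hm : m ∈ P.1 := by rw [h]; exact Submodule.mem_top
    exact hm

/-- An essential extension is detected on the submodule: a subspace stable under the dual action
and meeting `M` trivially is zero. -/
theorem IsInjectiveHull.eq_bot_of_dualAct_mem (hi : IsInjectiveHull k C i) (N : Submodule k E)
    (hN : ∀ x ∈ N, ∀ η : Module.Dual k C, dualAct C η x ∈ N)
    (h : ∀ m, i m ∈ N → m = 0) : N = ⊥ := by
  refine congr($(hi.essential (Subcomodule.ofDualAct C N hN) ?_).1)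
  rw [Submodule.eq_bot_iff]
  rintro _ ⟨hx, m, rfl⟩
  rw [h m hx, map_zero]

end Essential

section HullOfTrivial

variable {k H : Type u} [Field k] [Ring H] [HopfAlgebra k H]

/-- The regular right comodule: a coalgebra coacting on itself by its comultiplication. -/
@[reducible] noncomputable def regularRightComodule (k C : Type*) [Field k] [AddCommGroup C]
    [Module k C] [Coalgebra k C] : RightComodule k C C where
  coact := comul
  coassoc := Coalgebra.coassoc
  counit_coact := by
    ext x
    simp

variable {E : Type u} [AddCommGroup E] [Module k E] [RightComodule k H E] {i : k →ₗ[k] E}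

/-- The inclusion of `k` in its injective hull extends along the unit `k → H`. -/
theorem IsInjectiveHull.exists_extension (hi : IsInjectiveHull k H i) :
    ∃ γ : H →ₗ[k] E, γ 1 = i 1 ∧
      ∀ h, RightComodule.coact (C := H) (γ h) = γ.rTensor H (comul (R := k) h) := by
  let := regularRightComodule k H
  have hu : IsComoduleHom k H (Algebra.linearMap k H) := by
    ext
    simp only [RightComodule.coact, LinearMap.comp_apply, Algebra.linearMap_apply, map_one,
      LinearMap.flip_apply, TensorProduct.mk_apply, LinearMap.rTensor_tmul]
    exact Bialgebra.comul_one
  obtain ⟨γ, hγ, hγi⟩ := hi.isInjective k H (Algebra.linearMap k H) i hu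
    (fun a b hab => by simpa using congr(counit (R := k) $hab)) hi.isComoduleHom
  refine ⟨γ, ?_, fun h => hγ.coact_apply h⟩
  simpa using congr($hγi 1)

/-- The injective hull of the trivial comodule of a co-Frobenius Hopf algebra embeds, by a
coefficient map, in the image of a finite rank endomorphism of `H`. -/
theorem IsInjectiveHull.finiteDimensional_of_isCoFrobenius (hi : IsInjectiveHull k H i)
    (hH : IsCoFrobenius k H) : FiniteDimensional k E := by
  obtain ⟨τ, hτ1, hτ⟩ := hH.exists_finite_range_evalLeft_comul
  have hi1 : i 1 ≠ 0 := fun h => one_ne_zero (hi.injective (h.trans (map_zero i).symm))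
  obtain ⟨σ, hσ⟩ : ∃ σ : Module.Dual k E, σ (i 1) = 1 :=
    Module.Projective.exists_dual_eq_one k hi1
  let ν : Module.Dual k E := τ ∘ₗ comoduleCoeff H σ
  have hν : ∀ e, comoduleCoeff H ν e = (evalLeft H τ ∘ₗ comul) (comoduleCoeff H σ e) := by
    intro e
    rw [LinearMap.comp_apply, comul_comoduleCoeff]
    simp only [comoduleCoeff, ν, evalLeft, LinearMap.comp_apply, LinearMap.rTensor_comp]
  have hker : LinearMap.ker (comoduleCoeff H ν) = ⊥ := by
    refine hi.eq_bot_of_dualAct_mem _ (fun x hx η => ?_) fun a ha => ?_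
    · rw [LinearMap.mem_ker] at hx ⊢
      rw [comoduleCoeff_dualAct, hx]
      simp
    · rw [LinearMap.mem_ker] at ha
      have e1 : i a = a • i 1 := by rw [← map_smul, smul_eq_mul, mul_one]
      have e2 : ν (i 1) = 1 := by
        simp [ν, hi.isComoduleHom.comoduleCoeff_map_one, hσ, hτ1]
      rw [e1, map_smul, hi.isComoduleHom.comoduleCoeff_map_one, e2, one_smul] at ha
      have := congr(counit (R := k) $ha)
      simpa using this
  refine FiniteDimensional.of_injective ((comoduleCoeff H ν).codRestrict
    (LinearMap.range (evalLeft H τ ∘ₗ comul)) fun e => ?_) ?_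
  · rw [hν]
    exact ⟨_, rfl⟩
  · rw [← LinearMap.ker_eq_bot, LinearMap.ker_codRestrict, hker]

end HullOfTrivial

/-! ### The dimension of an injective hull -/

section DimensionBound

variable {k H : Type*} [Field k] [Ring H] [HopfAlgebra k H] {M : Type*} [AddCommGroup M]
  [Module k M] [RightComodule k H M]

/-- The map `x ↦ ∑ S(P(x₀)) x₁` attached to a linear map `P` from a comodule to `H`. -/
noncomputable def antipodeMulCoact (P : M →ₗ[k] H) : M →ₗ[k] H :=
  LinearMap.mul' k H ∘ₗ (antipode k ∘ₗ P).rTensor H ∘ₗ RightComodule.coact (C := H)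

/-- If `Δ(P(x)) = ∑ a_j ⊗ P_j(x)`, then the maps `x ↦ E(x) = ∑ S(P(x₀)) x₁` and `E_j`, formed in
the same way from `P_j`, are related by `∑ E(x₀) ⊗ x₁ = ∑ (1 ⊗ a_j) Δ(E_j(x))`. -/
theorem rTensor_antipodeMulCoact {ι : Type*} [Fintype ι] (P : M →ₗ[k] H) (a : ι → H)
    (Q : ι → M →ₗ[k] H) (hP : ∀ m, comul (R := k) (P m) = ∑ j, a j ⊗ₜ[k] Q j m) (x : M) :
    (antipodeMulCoact P).rTensor H (RightComodule.coact x) =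
      ∑ j, ((1 : H) ⊗ₜ[k] a j) * comul (R := k) (antipodeMulCoact (Q j) x) := by
  have hc := coact_coassoc_apply (k := k) (C := H) x
  -- `∑ S(P(x₀)) x₁ ⊗ x₂ = ∑ (S(P(x₀)) ⊗ 1) Δ(x₁)`
  let Φ : M ⊗[k] (H ⊗[k] H) →ₗ[k] H ⊗[k] H :=
    (LinearMap.mul' k H ∘ₗ (antipode k ∘ₗ P).rTensor H).rTensor H ∘ₗ
      (TensorProduct.assoc k M H H).symm.toLinearMap
  have hΦ : ∀ (m : M) (X : H ⊗[k] H), Φ (m ⊗ₜ X) = (antipode k (P m) ⊗ₜ 1) * X := by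
    intro m X
    induction X with
    | zero => simp
    | tmul b c => simp [Φ]
    | add x y hx hy => simp only [TensorProduct.tmul_add, mul_add, map_add, hx, hy]
  have e1 : (antipodeMulCoact P).rTensor H (RightComodule.coact x) =
      Φ ((comul (R := k) (A := H)).lTensor M (RightComodule.coact x)) := by
    rw [← hc]
    simp only [Φ, antipodeMulCoact, LinearMap.comp_apply, LinearMap.rTensor_comp,
      LinearEquiv.coe_toLinearMap, LinearEquiv.symm_apply_apply]
  rw [e1]
  have key : ∀ z : M ⊗[k] H, Φ ((comul (R := k) (A := H)).lTensor M z) =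
      ∑ j, ((1 : H) ⊗ₜ[k] a j) * comul (R := k)
        (LinearMap.mul' k H ((antipode k ∘ₗ Q j).rTensor H z)) := by
    intro z
    induction z with
    | zero => simp
    | tmul m c =>
      have hr : (antipode k (P m) ⊗ₜ[k] (1 : H)) =
          ∑ j, ((1 : H) ⊗ₜ[k] a j) * comul (R := k) (antipode k (Q j m)) := by
        exact (sum_one_tmul_mul_comul_antipode (k := k)
          ⟨Finset.univ, a, fun j => Q j m, (hP m).symm⟩).symm
      simp [hΦ, hr, Finset.sum_mul, mul_assoc]
    | add x y hx hy => simp only [map_add, hx, hy, mul_add, Finset.sum_add_distrib]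
  exact key _

end DimensionBound

section DimensionOfHull

variable {k H : Type u} [Field k] [Ring H] [HopfAlgebra k H]
  {E : Type u} [AddCommGroup E] [Module k E] [RightComodule k H E] {i : k →ₗ[k] E}
  {S : Type u} [AddCommGroup S] [Module k S] [RightComodule k H S]
  {F : Type u} [AddCommGroup F] [Module k F] [RightComodule k H F] {j : S →ₗ[k] F}

/-- The injective hull of `S` embeds in `S ⊗ E(k)`. For a linear retraction `σ` onto `S` and a
colinear map `γ : H → E(k)` with `γ(1)` spanning the image of `k`, the embedding is
`x ↦ ∑ σ(x₀)₀ ⊗ γ(S(σ(x₀)₁) x₁)`; its kernel is a subcomodule, and it maps `s ∈ S` to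
`s ⊗ γ(1)`. -/
theorem IsInjectiveHull.finiteDimensional_and_finrank_le [FiniteDimensional k S]
    [FiniteDimensional k E] (hi : IsInjectiveHull k H i) (hj : IsInjectiveHull k H j) :
    FiniteDimensional k F ∧
      Module.finrank k F ≤ Module.finrank k S * Module.finrank k E := by
  obtain ⟨γ, hγ1, hγ⟩ := hi.exists_extension
  obtain ⟨σ, hσ⟩ := LinearMap.exists_leftInverse_of_injective j
    (LinearMap.ker_eq_bot.2 hj.injective)
  let b := Module.finBasis k S
  let P : Module.Dual k S → F →ₗ[k] H := fun ζ => comoduleCoeff H ζ ∘ₗ σ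
  -- the components of `x ↦ ∑ σ(x₀)₀ ⊗ γ(S(σ(x₀)₁) x₁)` in the basis `b`
  let g : F →ₗ[k] (Fin (Module.finrank k S) → E) :=
    LinearMap.pi fun l => γ ∘ₗ antipodeMulCoact (P (b.coord l))
  have hcoact : ∀ s : S, RightComodule.coact (C := H) s =
      ∑ l, b l ⊗ₜ[k] comoduleCoeff H (b.coord l) s := by
    intro s
    have key : ∀ z : S ⊗[k] H, z =
        ∑ l, b l ⊗ₜ[k] TensorProduct.lid k H ((b.coord l).rTensor H z) := by
      intro z
      induction z with
      | zero => simp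
      | tmul m c =>
        simp only [LinearMap.rTensor_tmul, TensorProduct.lid_tmul, Module.Basis.coord_apply,
          TensorProduct.tmul_smul, TensorProduct.smul_tmul', ← TensorProduct.sum_tmul, b.sum_repr]
      | add x y hx hy =>
        simp only [map_add, TensorProduct.tmul_add, Finset.sum_add_distrib, ← hx, ← hy]
    exact key _
  have hP : ∀ ζ m, comul (R := k) (P ζ m) =
      ∑ l, comoduleCoeff H ζ (b l) ⊗ₜ[k] P (b.coord l) m := by
    intro ζ m
    simp only [P, LinearMap.comp_apply]
    rw [comul_comoduleCoeff, hcoact, map_sum]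
    simp
  have hγmul : ∀ (a : H) (X : H ⊗[k] H), γ.rTensor H ((1 ⊗ₜ a) * X) =
      (LinearMap.mulLeft k a).lTensor E (γ.rTensor H X) := by
    intro a X
    induction X with
    | zero => simp
    | tmul b c => simp
    | add x y hx hy => simp only [mul_add, map_add, hx, hy]
  have hker : LinearMap.ker g = ⊥ := by
    refine hj.eq_bot_of_dualAct_mem _ (fun x hx η => ?_) fun s hs => ?_
    · rw [LinearMap.mem_ker] at hx ⊢
      have hx' : ∀ l, γ (antipodeMulCoact (P (b.coord l)) x) = 0 := fun l => congrFun hx l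
      funext l
      change (γ ∘ₗ antipodeMulCoact (P (b.coord l))) (dualAct H η x) = 0
      rw [map_dualAct, LinearMap.rTensor_comp, LinearMap.comp_apply,
        rTensor_antipodeMulCoact _ _ _ (hP (b.coord l)), map_sum]
      simp [hγmul, ← hγ, hx']
    · rw [LinearMap.mem_ker] at hs
      refine b.ext_elem fun l => ?_
      have hl : γ (antipodeMulCoact (P (b.coord l)) (j s)) = 0 := congrFun hs l
      have e1 : antipodeMulCoact (P (b.coord l)) (j s) = b.coord l s • 1 := by
        have e2 : (antipode k ∘ₗ P (b.coord l)) ∘ₗ j =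
            antipode k ∘ₗ comoduleCoeff H (b.coord l) := by
          ext y
          simp [P, show σ (j y) = y from congr($hσ y)]
        rw [antipodeMulCoact, LinearMap.comp_apply, LinearMap.comp_apply,
          hj.isComoduleHom.coact_apply, ← LinearMap.comp_apply (LinearMap.rTensor H _),
          ← LinearMap.rTensor_comp, e2, LinearMap.rTensor_comp, LinearMap.comp_apply,
          ← comul_comoduleCoeff, mul_antipode_rTensor_comul_apply, counit_comoduleCoeff,
          Algebra.algebraMap_eq_smul_one]
      rw [e1, map_smul, hγ1] at hl
      have hi1 : i 1 ≠ 0 := fun h => one_ne_zero (hi.injective (h.trans (map_zero i).symm))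
      simpa using (smul_eq_zero.1 hl).resolve_right hi1
  have hinj := LinearMap.ker_eq_bot.1 hker
  refine ⟨FiniteDimensional.of_injective g hinj, ?_⟩
  simpa [Module.finrank_pi_fintype] using LinearMap.finrank_le_finrank_of_injective hinj

end DimensionOfHull

/-! ### The size of the layers of an injective hull -/

section CoactionAntipode

variable {k H : Type*} [Field k] [Ring H] [HopfAlgebra k H] {M : Type*} [AddCommGroup M]
  [Module k M] [RightComodule k H M]

/-- The map `x ↦ ∑ P(x₀) S(x₁)` attached to a linear map `P` from a comodule to `H`. -/
noncomputable def coactMulAntipode (P : M →ₗ[k] H) : M →ₗ[k] H :=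
  LinearMap.mul' k H ∘ₗ TensorProduct.map P (antipode k) ∘ₗ RightComodule.coact (C := H)

/-- With `D(x) = ∑ P(x₀) S(x₁)` and `χ(h) = ∑ φ(h₂) h₁`, this is the `η`-component of the identity
`∑ φ(P(x₀)₂ S(x₁)) P(x₀)₁ = ∑ χ(D(x₀)) x₁`. -/
theorem dual_coactMulAntipode (P : M →ₗ[k] H) (η φ : Module.Dual k H) (x : M) :
    φ (coactMulAntipode (evalLeft H η ∘ₗ comul ∘ₗ P) x) =
      η (LinearMap.mul' k H ((evalRight H φ ∘ₗ comul ∘ₗ coactMulAntipode P).rTensor H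
        (RightComodule.coact x))) := by
  have hc := coact_coassoc_apply (k := k) (C := H) x
  let Φ : M ⊗[k] (H ⊗[k] H) →ₗ[k] H :=
    LinearMap.mul' k H ∘ₗ (evalRight H φ ∘ₗ comul ∘ₗ LinearMap.mul' k H ∘ₗ
      TensorProduct.map P (antipode k)).rTensor H ∘ₗ (TensorProduct.assoc k M H H).symm.toLinearMap
  have e1 : LinearMap.mul' k H ((evalRight H φ ∘ₗ comul ∘ₗ coactMulAntipode P).rTensor H
      (RightComodule.coact x)) =
      Φ ((comul (R := k) (A := H)).lTensor M (RightComodule.coact x)) := by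
    rw [← hc]
    simp only [Φ, coactMulAntipode, LinearMap.comp_apply, LinearMap.rTensor_comp,
      LinearEquiv.coe_toLinearMap, LinearEquiv.symm_apply_apply]
  rw [e1]
  have key : ∀ z : M ⊗[k] H,
      φ (LinearMap.mul' k H (TensorProduct.map (evalLeft H η ∘ₗ comul ∘ₗ P) (antipode k) z)) =
      η (Φ ((comul (R := k) (A := H)).lTensor M z)) := by
    intro z
    induction z with
    | zero => simp
    | tmul m c =>
      have e2 : Φ ((comul (R := k) (A := H)).lTensor M (m ⊗ₜ c)) =
          evalRight H φ (comul (R := k) (P m) * (1 ⊗ₜ antipode k c)) := by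
        rw [← sum_comul_antipode_mul_tmul_one (ℛ k c), Finset.mul_sum, map_sum,
          LinearMap.lTensor_tmul, ← (ℛ k c).eq, TensorProduct.tmul_sum, map_sum]
        refine Finset.sum_congr rfl fun i _ => ?_
        simp [Φ, ← mul_assoc, evalRight_mul_tmul_one]
      rw [e2, dual_evalRight, evalLeft_mul_one_tmul]
      simp
    | add x y hx hy => simp only [map_add, hx, hy]
  exact key _

theorem antipode_evalRight_comul {E : Type*} [AddCommGroup E] [Module k E] [RightComodule k H E]
    {γ : H →ₗ[k] E}
    (hγ : ∀ h, RightComodule.coact (C := H) (γ h) = γ.rTensor H (comul (R := k) h))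
    (ψ : Module.Dual k E) (h : H) :
    antipode k (evalRight H (ψ ∘ₗ γ ∘ₗ antipode k) (comul h)) =
      comoduleCoeff H ψ (γ (antipode k h)) := by
  simp only [comoduleCoeff, LinearMap.comp_apply, hγ]
  rw [comul_antipode_eq_sum (ℛ k h), ← (ℛ k h).eq]
  simp [map_sum]

end CoactionAntipode

section Layers

variable {k H : Type u} [Field k] [Ring H] [HopfAlgebra k H]
  {E : Type u} [AddCommGroup E] [Module k E] [RightComodule k H E] {i : k →ₗ[k] E}
  {S : Type u} [AddCommGroup S] [Module k S] [RightComodule k H S]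
  {F : Type u} [AddCommGroup F] [Module k F] [RightComodule k H F] {j : S →ₗ[k] F}

/-- If `d` bounds the dimensions of the composition factors of `E(k)`, then every layer `B / A` of
`E(S)` satisfies `dim S ≤ d · dim (B / A)`.

For a linear endomorphism `σ` of `E(S)` killing `A` and congruent to the identity modulo `A`, and
a colinear `γ : H → E(k)` with `γ(1)` spanning the image of `k`, the formula
`(ψ, x) ↦ ∑ ψ(γ(S(b₁ S(x₁)))) b₀`, where `b = σ(x₀)`, defines a pairing of the functionals on
`E(k)` with `B / A`, valued in `B` and congruent to `ψ(γ(1)) x` modulo `A`. For every subcomodule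
`N` of `E(k)`, the values with `ψ` vanishing on `N` span a subcomodule of `E(S)`, which is nonzero
for `N = 0`. Take `N` maximal such that it is nonzero, and `N'` covering `N`: the span then has
dimension at most `dim (N' / N) · dim (B / A)`, and it contains `S`. The proof works with the
annihilator `X N` of the span: `ξ ∈ X N` when `T_ξ(x) = ∑ γ(S(ξ(b₀) b₁ S(x₁)))` is in `N` for all
`x ∈ B`. -/
theorem IsInjectiveHull.finrank_add_mul_finrank_le [FiniteDimensional k E] [FiniteDimensional k F]
    (hS : Function.Injective (antipode k (A := H)))
    (hi : IsInjectiveHull k H i) (hj : IsInjectiveHull k H j) (hsimple : IsSimpleComodule k H S)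
    {d : ℕ} (hd : ∀ N N' : Subcomodule k H E, N ⋖ N' →
      Module.finrank k (N'.1 ⧸ N.1.submoduleOf N'.1) ≤ d)
    {A B : Subcomodule k H F} (hAB : A < B) :
    Module.finrank k S + d * Module.finrank k A.1 ≤ d * Module.finrank k B.1 := by
  obtain ⟨γ, hγ1, hγ⟩ := hi.exists_extension
  have hi1 : i 1 ≠ 0 := fun h => one_ne_zero (hi.injective (h.trans (map_zero i).symm))
  obtain ⟨C, hC⟩ := Submodule.exists_isCompl A.1
  -- a linear endomorphism of `F` that kills `A` and is the identity modulo `A`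
  obtain ⟨σ, hσA, hσ⟩ : ∃ σ : F →ₗ[k] F, (∀ x ∈ A.1, σ x = 0) ∧ ∀ x, σ x - x ∈ A.1 := by
    refine ⟨C.projection A.1 hC.symm,
      fun x hx => (Submodule.projection_apply_eq_zero_iff hC.symm).2 hx, fun x => ?_⟩
    rw [← Submodule.projection_apply_eq_zero_iff hC.symm, map_sub, sub_eq_zero]
    exact Submodule.projection_apply_of_mem_left hC.symm (Submodule.projection_apply_mem hC.symm x)
  let D : Module.Dual k F → F →ₗ[k] H := fun ξ => coactMulAntipode (comoduleCoeff H ξ ∘ₗ σ)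
  -- `D_ξ` vanishes on `A`
  have hDA : ∀ ξ, ∀ x ∈ A.1, D ξ x = 0 := by
    intro ξ x hx
    have := rTensor_eq_zero_of_mem_range (A.2 x hx) (f := comoduleCoeff H ξ ∘ₗ σ)
      (fun y hy => by simp [hσA y hy])
    simp only [D, coactMulAntipode, LinearMap.comp_apply]
    rw [← LinearMap.lTensor_comp_rTensor, LinearMap.comp_apply, this]
    simp
  -- `D_ξ(x) = ξ(x) 1` for `ξ` vanishing on `A`
  have hDξ : ∀ ξ : Module.Dual k F, (∀ x ∈ A.1, ξ x = 0) → ∀ x, D ξ x = ξ x • 1 := by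
    intro ξ hξ x
    have e1 : comoduleCoeff H ξ ∘ₗ σ = comoduleCoeff H ξ := by
      ext y
      have := A.comoduleCoeff_eq_zero (hσ y) hξ
      rwa [map_sub, sub_eq_zero] at this
    simp only [D, coactMulAntipode, e1, LinearMap.comp_apply]
    rw [← LinearMap.lTensor_comp_rTensor, LinearMap.comp_apply, ← comul_comoduleCoeff,
      mul_antipode_lTensor_comul_apply, counit_comoduleCoeff, Algebra.algebraMap_eq_smul_one]
  -- `T_ξ = γ ∘ S ∘ D_ξ`
  let T : Module.Dual k F →ₗ[k] F →ₗ[k] E :=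
    { toFun := fun ξ => γ ∘ₗ antipode k ∘ₗ D ξ
      map_add' := fun a b => by
        ext x
        simp only [D, coactMulAntipode, comoduleCoeff, LinearMap.rTensor_add, LinearMap.comp_add,
          LinearMap.add_comp, TensorProduct.map_add_left, LinearMap.add_apply]
      map_smul' := fun a b => by
        ext x
        simp only [D, coactMulAntipode, comoduleCoeff, LinearMap.rTensor_smul, LinearMap.comp_smul,
          LinearMap.smul_comp, TensorProduct.map_smul_left, LinearMap.smul_apply,
          RingHom.id_apply] }
  let X : Subcomodule k H E → Submodule k (Module.Dual k F) := fun N =>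
    { carrier := {ξ | ∀ x ∈ B.1, T ξ x ∈ N.1}
      add_mem' := fun {a b} ha hb x hx => by
        rw [map_add]
        exact N.1.add_mem (ha x hx) (hb x hx)
      zero_mem' := fun x _ => by simp
      smul_mem' := fun c a ha x hx => by
        rw [map_smul]
        exact N.1.smul_mem _ (ha x hx) }
  -- `X N` is stable under the transpose of the dual action, so its annihilator is a subcomodule;
  -- the antipode being injective, `χ(h) = ∑ ψ(γ(S(h₂))) h₁` vanishes when `γ(S(h)) ∈ N` and `ψ`
  -- annihilates `N`
  have hX : ∀ N, ∀ ξ ∈ X N, ∀ η : Module.Dual k H, ξ ∘ₗ dualAct H η ∈ X N := by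
    intro N ξ hξ η x hx
    refine (Subspace.forall_mem_dualAnnihilator_apply_eq_zero_iff _ _).1 fun ψ hψ => ?_
    have e1 : comoduleCoeff H (ξ ∘ₗ dualAct H η) ∘ₗ σ =
        evalLeft H η ∘ₗ comul ∘ₗ (comoduleCoeff H ξ ∘ₗ σ) := by
      ext y
      exact comoduleCoeff_comp_dualAct ξ η (σ y)
    have e2 : (evalRight H (ψ ∘ₗ γ ∘ₗ antipode k) ∘ₗ comul ∘ₗ D ξ).rTensor H
        (RightComodule.coact x) = 0 := by
      refine rTensor_eq_zero_of_mem_range (B.2 x hx) fun y hy => hS ?_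
      rw [map_zero]
      refine (antipode_evalRight_comul hγ ψ _).trans ?_
      exact N.comoduleCoeff_eq_zero (hξ y hy) ((Submodule.mem_dualAnnihilator _).1 hψ)
    change (ψ ∘ₗ γ ∘ₗ antipode k) (coactMulAntipode _ x) = 0
    rw [e1, dual_coactMulAntipode]
    change η (LinearMap.mul' k H ((evalRight H (ψ ∘ₗ γ ∘ₗ antipode k) ∘ₗ comul ∘ₗ D ξ).rTensor H
        (RightComodule.coact x))) = 0
    rw [e2, map_zero, map_zero]
  -- a functional vanishing on `A` but not at `x ∈ B` has `T_ξ(x) = ξ(x) γ(1) ≠ 0`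
  have hXbot : X ⊥ ≠ ⊤ := by
    obtain ⟨x, hxB, hxA⟩ := SetLike.exists_of_lt (show A.1 < B.1 from hAB)
    obtain ⟨ξ, hξx, hξA⟩ := Submodule.exists_dual_map_eq_bot_of_notMem hxA inferInstance
    intro h
    have h1 : ξ ∈ X ⊥ := by rw [h]; exact Submodule.mem_top
    have h2 : γ (antipode k (D ξ x)) = 0 := (Submodule.mem_bot k).1 (h1 x hxB)
    rw [hDξ ξ (fun y hy => (Submodule.eq_bot_iff _).1 hξA _ (Submodule.mem_map_of_mem hy)),
      map_smul, antipode_one, map_smul, hγ1] at h2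
    exact (smul_ne_zero hξx hi1) h2
  have hmono : StrictMono (fun N : Subcomodule k H E => N.1) := fun _ _ h => h
  have hwf : WellFoundedLT (Subcomodule k H E) := hmono.wellFoundedLT
  have hwf' : WellFoundedGT (Subcomodule k H E) := hmono.wellFoundedGT
  obtain ⟨N, hN, hNmax⟩ := hwf'.wf.has_min {N | X N ≠ ⊤} ⟨⊥, hXbot⟩
  have hNtop : N < ⊤ := by
    refine lt_top_iff_ne_top.2 fun h => hN ?_
    rw [h, eq_top_iff]
    intro ξ _ x _
    exact Submodule.mem_top
  obtain ⟨N', hNN', hN'min⟩ := hwf.wf.has_min {N' | N < N'} ⟨⊤, hNtop⟩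
  have hcov : N ⋖ N' := ⟨hNN', fun K hK hK' => hN'min K hK hK'⟩
  have hXN' : X N' = ⊤ := by
    by_contra h
    exact hNmax N' h hNN'
  let W : Subcomodule k H F := Subcomodule.ofDualAct H (X N).dualCoannihilator fun e he η => by
    rw [Submodule.mem_dualCoannihilator] at he ⊢
    intro ξ hξ
    exact he _ (hX N ξ hξ η)
  have hW : W ≠ ⊥ := by
    intro h
    have h1 : (X N).dualCoannihilator = ⊥ := congr($h.1)
    apply hN
    rw [← Subspace.dualCoannihilator_dualAnnihilator_eq (W := X N), h1,
      Submodule.dualAnnihilator_bot]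
  have hSW : Module.finrank k S ≤ Module.finrank k W.1 := by
    rw [← LinearMap.finrank_range_of_inj hj.injective]
    exact Submodule.finrank_mono (hj.range_le hsimple W hW)
  have hdimX : Module.finrank k (X N) + Module.finrank k W.1 = Module.finrank k F :=
    Subspace.finrank_add_finrank_dualCoannihilator_eq (X N)
  -- `C ⊓ B` is a complement of `A` in `B`
  have hsup : C ⊓ B.1 ⊔ A.1 = B.1 := by
    rw [sup_comm, ← sup_inf_assoc_of_le C (show A.1 ≤ B.1 from hAB.le), hC.sup_eq_top, top_inf_eq]
  have hdimC : Module.finrank k ↥(C ⊓ B.1) + Module.finrank k A.1 = Module.finrank k B.1 := by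
    have h1 := Submodule.finrank_sup_add_finrank_inf_eq (C ⊓ B.1) A.1
    have h3 : C ⊓ B.1 ⊓ A.1 = ⊥ := by
      rw [inf_right_comm, hC.symm.inf_eq_bot, bot_inf_eq]
    rw [hsup, h3, finrank_bot, add_zero] at h1
    exact h1.symm
  -- the map `ξ ↦ T_ξ`, from `C ⊓ B` to `N' / N`, has kernel `X N`
  let R : Module.Dual k F →ₗ[k] ↥(C ⊓ B.1) →ₗ[k] (N'.1 ⧸ N.1.submoduleOf N'.1) :=
    { toFun := fun ξ => (N.1.submoduleOf N'.1).mkQ ∘ₗ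
        ((T ξ).domRestrict (C ⊓ B.1)).codRestrict N'.1 fun x =>
          (show ξ ∈ X N' by rw [hXN']; exact Submodule.mem_top) x.1 x.2.2
      map_add' := fun a b => by
        ext x
        simp only [map_add]
        rfl
      map_smul' := fun a b => by
        ext x
        simp only [map_smul]
        rfl }
  have hker : LinearMap.ker R ≤ X N := by
    intro ξ hξ x hx
    rw [← hsup] at hx
    obtain ⟨c, hc, a, ha, rfl⟩ := Submodule.mem_sup.1 hx
    have hTa : T ξ a = 0 := by
      change γ (antipode k (D ξ a)) = 0
      rw [hDA ξ a ha, map_zero, map_zero]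
    rw [map_add, hTa, add_zero]
    have hRc : R ξ ⟨c, hc⟩ = 0 := by rw [LinearMap.mem_ker.1 hξ, LinearMap.zero_apply]
    exact (Submodule.Quotient.mk_eq_zero (N.1.submoduleOf N'.1)).1 hRc
  have h1 := LinearMap.finrank_range_add_finrank_ker R
  have h2 := Submodule.finrank_mono hker
  have h3 : Module.finrank k (LinearMap.range R) ≤ Module.finrank k ↥(C ⊓ B.1) * d := by
    refine (Submodule.finrank_le _).trans ?_
    rw [Module.finrank_linearMap]
    exact Nat.mul_le_mul_left _ (hd N N' hcov)
  rw [Subspace.dual_finrank_eq] at h1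
  have h4 : Module.finrank k S ≤ Module.finrank k ↥(C ⊓ B.1) * d := by omega
  rw [← hdimC, mul_add]
  rw [mul_comm] at h4
  omega

end Layers

/-! ### The composition length -/

theorem exists_isGreatest_compositionFactorDims (k C : Type*) {M : Type*} [Field k]
    [AddCommGroup C] [Module k C] [Coalgebra k C] [AddCommGroup M] [Module k M]
    [RightComodule k C M] [FiniteDimensional k M] [Nontrivial M] :
    ∃ d, IsGreatest (compositionFactorDims k C M) d := by
  have hmono : StrictMono (fun N : Subcomodule k C M => N.1) := fun _ _ h => h
  have hwf : WellFoundedLT (Subcomodule k C M) := hmono.wellFoundedLT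
  have hbt : (⊥ : Subcomodule k C M) < ⊤ := bot_lt_top (α := Submodule k M)
  obtain ⟨B, hB, hBmin⟩ := hwf.wf.has_min {B : Subcomodule k C M | ⊥ < B} ⟨⊤, hbt⟩
  have hne : (compositionFactorDims k C M).Nonempty :=
    ⟨_, ⊥, B, ⟨hB, fun K hK hK' => hBmin K hK hK'⟩, rfl⟩
  have hbdd : BddAbove (compositionFactorDims k C M) := by
    refine ⟨Module.finrank k M, ?_⟩
    rintro _ ⟨A, B, -, rfl⟩
    exact (Submodule.finrank_quotient_le _).trans (Submodule.finrank_le _)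
  exact ⟨_, Nat.sSup_mem hne hbdd, fun _ hn => le_csSup hbdd hn⟩

theorem mainTheorem2 {k H : Type u} [Field k] [Ring H] [HopfAlgebra k H]
    (hH : IsCoFrobenius k H)
    {S : Type u} [AddCommGroup S] [Module k S] [RightComodule k H S]
    (hS : IsSimpleComodule k H S)
    {ES : Type u} [AddCommGroup ES] [Module k ES] [RightComodule k H ES]
    (iS : S →ₗ[k] ES) (hES : IsInjectiveHull k H iS)
    {Ek : Type u} [AddCommGroup Ek] [Module k Ek] [RightComodule k H Ek]
    (ik : k →ₗ[k] Ek) (hEk : IsInjectiveHull k H ik) :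
    FiniteDimensional k Ek ∧
      ∃ d : ℕ, IsGreatest (compositionFactorDims k H Ek) d ∧
        comoduleLength k H ES ≤ ((d * Module.finrank k Ek : ℕ) : ℕ∞) := by
  have hfin : FiniteDimensional k Ek := hEk.finiteDimensional_of_isCoFrobenius hH
  have hnt : Nontrivial Ek := hEk.injective.nontrivial
  obtain ⟨d, hd⟩ := exists_isGreatest_compositionFactorDims k H (M := Ek)
  refine ⟨hfin, d, hd, Order.height_le fun p hp => ?_⟩
  have hfinS : FiniteDimensional k S := hS.finiteDimensional
  obtain ⟨hfinES, hdim⟩ := hEk.finiteDimensional_and_finrank_le hES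
  -- along a chain of subcomodules, `d · dim` grows by at least `dim S` at each step
  have hlayer : ∀ A B : Subcomodule k H ES, A < B →
      Module.finrank k S + d * Module.finrank k A.1 ≤ d * Module.finrank k B.1 :=
    fun A B hAB => hEk.finrank_add_mul_finrank_le hH.antipode_injective hES hS
      (fun N N' hN => hd.2 ⟨N, N', hN, rfl⟩) hAB
  have hchain : ∀ (n : ℕ) (hn : n < p.length + 1),
      n * Module.finrank k S ≤ d * Module.finrank k (p ⟨n, hn⟩).1 := by
    intro n
    induction n with
    | zero => simp
    | succ n ih =>
      intro hn
      have h1 := ih (by omega)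
      have h2 := hlayer _ _ (p.strictMono (show (⟨n, by omega⟩ : Fin (p.length + 1)) < ⟨n + 1, hn⟩
        from Nat.lt_succ_self n))
      rw [add_mul, one_mul]
      omega
  have hlast := (hchain p.length (Nat.lt_succ_self _)).trans
    (Nat.mul_le_mul_left d ((Submodule.finrank_le _).trans hdim))
  have hpos : 0 < Module.finrank k S := by
    have := hS.1
    exact Module.finrank_pos
  refine Nat.cast_le.2 (Nat.le_of_mul_le_mul_right (hlast.trans (le_of_eq ?_)) hpos)
  ring
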